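/- Let $K$ be a finite extension of $\mathbb{Q}_p$ inside a fixed algebraic closure $\overline{\mathbb{Q}}_p$, with the absolute value $|\cdot|$ extending the $p$-adic one; let $\mathcal{O}_K$ be its ring of integers, $\pi$ a uniformizer of $\mathcal{O}_K$ and $q$ the number of elements of the residue field. Let $\varphi\in\mathcal{O}_K[[x]]$ satisfy $\varphi(x)\equiv \pi x \bmod \deg 2$ and $\varphi(x)\equiv x^q \bmod \pi$, and let $F$ be the Lubin--Tate formal group law over $\mathcal{O}_K$ associated to $\varphi$, so that $[\pi]=\varphi$, where $[a](x)$ denotes the endomorphism of $F$ with linear coefficient $a\in\mathcal{O}_K$. Write $x\oplus y=F(x,y)$. For $n\ge 0$ let $\mathfrak{F}_n$ be the kernel of $[\pi^{n+1}]$ on $\{x\in\overline{\mathbb{Q}}_p : |x|<1\}$ and $K_n=K(\mathfrak{F}_n)$. Fix a sequence $(u_n)_{n\ge0}$ with $u_n\in\mathfrak{F}_n$, $u_0\ne0$ and $[\pi](u_{n+1})=u_n$ for all $n$. Let $S$ be the set of all sequences $(x_n)_{n\ge 0}$ with $x_n$ in the maximal ideal of the ring of integers of $K_n$ and $$\mathrm{Tr}^{LT}_{K_{n+1}/K_n}(x_{n+1})=[q/\pi](x_n)\quad\text{for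 all } n\ge 0,$$ where $\mathrm{Tr}^{LT}_{K_{n+1}/K_n}(x)=\sigma_1(x)\oplus\cdots\oplus\sigma_q(x)$ and $\sigma_1,\dots,\sigma_q$ are the elements of $\mathrm{Gal}(K_{n+1}/K_n)$. Suppose that $(\alpha_i)\in S$ is interpolated by a nonzero power series $f(x)=\sum_j a_jx^j\in\mathcal{O}_K[[x]]$, that is, $f(u_i)=\alpha_i$ for all $i\ge 0$. Then $\lim_{i\to\infty}|\alpha_i|$ exists and is nonzero; moreover, the maximum of the $|a_j|$, $j\ge0$, is attained, and the limit is equal to it. -/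

import Mathlib

open Filter Topology

noncomputable section

namespace LubinTate

variable {p : ℕ} [Fact p.Prime]

/-- The ring of integers `𝒪_K = {x ∈ K : |x| ≤ 1}` of an extension `K` of `ℚ_p` inside the fixed
algebraic closure of `ℚ_p`; the absolute value on `K` is the one of `PadicAlgCl p`, that is, the
unique extension of the `p`-adic absolute value. -/
abbrev integers (K : IntermediateField ℚ_[p] (PadicAlgCl p)) : ValuationSubring K :=
  (NormedField.valuation (K := K)).valuationSubring

/-- The number `q` of elements of the residue field of `K`. -/
def residueCard (K : IntermediateField ℚ_[p] (PadicAlgCl p)) : ℕ :=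
  Nat.card (IsLocalRing.ResidueField (integers K))

variable {K : IntermediateField ℚ_[p] (PadicAlgCl p)}

/-- The inclusion of `𝒪_K` into the algebraic closure of `ℚ_p`. -/
def incl (a : integers K) : PadicAlgCl p := ((a : K) : PadicAlgCl p)

/-- `π` is a uniformizer of `𝒪_K`: it generates the maximal ideal. -/
def IsUniformizer (π : integers K) : Prop :=
  IsLocalRing.maximalIdeal (integers K) = Ideal.span {π}

/-- The value `g(x) = ∑ aₙ xⁿ` of a power series over `𝒪_K`. It is used for `|x| < 1` only, where
the sum converges (in the complete field `K(x)`). -/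
def eval (g : PowerSeries (integers K)) (x : PadicAlgCl p) : PadicAlgCl p :=
  ∑' n : ℕ, incl (PowerSeries.coeff n g) * x ^ n

/-- The value `F(x, y) = ∑ aᵢⱼ xⁱ yʲ` of a formal group law over `𝒪_K`, that is, `x ⊕ y`. It is used
for `|x| < 1` and `|y| < 1` only, where the sum converges (in the complete field `K(x, y)`). -/
def formalAdd (F : FormalGroup (integers K)) (x y : PadicAlgCl p) : PadicAlgCl p :=
  ∑' m : Fin 2 →₀ ℕ, incl (MvPowerSeries.coeff m F.toPowerSeries) * (x ^ m 0 * y ^ m 1)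

/-- The iterated formal sum `x₁ ⊕ x₂ ⊕ ⋯ ⊕ xᵣ` (which is `0` for the empty list). -/
def formalSum (F : FormalGroup (integers K)) (l : List (PadicAlgCl p)) : PadicAlgCl p :=
  l.foldr (formalAdd F) 0

/-- `g` is an endomorphism of the formal group law `F`: `g(0) = 0` and
`g(F(X, Y)) = F(g(X), g(Y))` as formal power series. -/
structure IsEndomorphism (F : FormalGroup (integers K)) (g : PowerSeries (integers K)) : Prop where
  constantCoeff_eq_zero : PowerSeries.constantCoeff g = 0
  map_add : PowerSeries.subst F.toPowerSeries g =
    MvPowerSeries.subst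
      ![PowerSeries.subst (MvPowerSeries.X (0 : Fin 2) : MvPowerSeries (Fin 2) (integers K)) g,
        PowerSeries.subst (MvPowerSeries.X (1 : Fin 2) : MvPowerSeries (Fin 2) (integers K)) g]
      F.toPowerSeries

/-- `g` is the series `[a]`, the (unique) endomorphism of `F` with linear coefficient `a`. -/
structure IsScalarSeries (F : FormalGroup (integers K)) (a : integers K)
    (g : PowerSeries (integers K)) : Prop where
  isEndomorphism : IsEndomorphism F g
  coeff_one : PowerSeries.coeff 1 g = a

/-- `F` is the Lubin-Tate formal group law associated to the uniformizer `π` of `𝒪_K` and to the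
series `φ ∈ 𝒪_K[[X]]`, where `φ(X) ≡ π X` modulo degree `2` and `φ(X) ≡ X ^ q` modulo `π`: the
commutative formal group law over `𝒪_K` that has `φ` as an endomorphism. So `φ = [π]`. -/
structure IsLubinTate (F : FormalGroup (integers K)) (π : integers K)
    (φ : PowerSeries (integers K)) : Prop where
  isUniformizer : IsUniformizer π
  modEq_frobenius : ∀ n, π ∣ PowerSeries.coeff n (φ - PowerSeries.X ^ residueCard K)
  isComm : F.IsComm
  isScalarSeries : IsScalarSeries F π φ

/-- The set `𝔉ₙ` of `n`-th level torsion points: the kernel of `[π ^ (n + 1)]`, the `(n + 1)`-fold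
iterate of `φ = [π]`, on the open unit disc of the algebraic closure. -/
def torsion (φ : PowerSeries (integers K)) (n : ℕ) : Set (PadicAlgCl p) :=
  {x | ‖x‖ < 1 ∧ (eval φ)^[n + 1] x = 0}

/-- The field `Kₙ = K(𝔉ₙ)`. -/
def level (φ : PowerSeries (integers K)) (n : ℕ) : IntermediateField K (PadicAlgCl p) :=
  IntermediateField.adjoin K (torsion φ n)

/-- The sequence `u` of torsion points: `uₙ ∈ 𝔉ₙ`, `u₀ ≠ 0` and `[π](uₙ₊₁) = uₙ`. -/
structure IsTorsionSequence (φ : PowerSeries (integers K)) (u : ℕ → PadicAlgCl p) : Prop where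
  mem_torsion : ∀ n, u n ∈ torsion φ n
  ne_zero : u 0 ≠ 0
  eval_succ : ∀ n, eval φ (u (n + 1)) = u n

/-- The Galois group of `Kₙ₊₁` over `Kₙ`: the automorphisms of `Kₙ₊₁` over `K` that fix `Kₙ`
pointwise. -/
def galois (φ : PowerSeries (integers K)) (n : ℕ) : Set (level φ (n + 1) ≃ₐ[K] level φ (n + 1)) :=
  {σ | ∀ z : level φ (n + 1), (z : PadicAlgCl p) ∈ level φ n → σ z = z}

/-- `y` is the Lubin-Tate trace of `x ∈ Kₙ₊₁` from `Kₙ₊₁` to `Kₙ`: the formal sum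
`σ₁(x) ⊕ ⋯ ⊕ σᵣ(x)` where `σ₁, …, σᵣ` are the distinct elements of the Galois group of `Kₙ₊₁` over
`Kₙ` (in any order, since `F` is commutative). -/
def IsTrace (F : FormalGroup (integers K)) (φ : PowerSeries (integers K)) (n : ℕ)
    (x : level φ (n + 1)) (y : PadicAlgCl p) : Prop :=
  ∃ l : List (level φ (n + 1) ≃ₐ[K] level φ (n + 1)),
    l.Nodup ∧ (∀ σ, σ ∈ l ↔ σ ∈ galois φ n) ∧
      y = formalSum F (l.map fun σ => (σ x : PadicAlgCl p))

/-- The set `S` of Lubin-Tate trace compatible sequences: the sequences `(xₙ)` with `xₙ` in the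
maximal ideal of `Kₙ` and with `Tr^LT(xₙ₊₁) = [q / π](xₙ)` for every `n`, the trace being taken
from `Kₙ₊₁` to `Kₙ`. -/
def compatibleSequences (F : FormalGroup (integers K)) (π : integers K)
    (φ : PowerSeries (integers K)) : Set (∀ n, level φ n) :=
  {x | (∀ n, ‖(x n : PadicAlgCl p)‖ < 1) ∧
    ∃ (c : integers K) (g : PowerSeries (integers K)),
      c * π = (residueCard K : integers K) ∧ IsScalarSeries F c g ∧
        ∀ n, IsTrace F φ n (x (n + 1)) (eval g (x n))}

end LubinTate

end

/-!
The points `uᵢ` approach the boundary of the unit disc, where the absolute value of a power series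
over `𝒪_K` tends to the largest absolute value of its coefficients.

Since `φ ≡ X ^ q` modulo `π` and `φ(0) = 0`, one has `|φ(x)| ≤ max (|x| ^ q) (|π| |x|)` on the open
unit disc (`IsLubinTate.norm_eval_le`). As `φ(uᵢ₊₁) = uᵢ`, the sequence `|uᵢ|` is monotone, and its
limit `L`, `0 < L ≤ 1`, satisfies the inequality `L ≤ max (L ^ q) (|π| L)`, so `L = 1`
(`IsTorsionSequence.tendsto_norm`).

Since the absolute value of `K` is discrete, the `|aⱼ|` have a maximum `M`
(`IsUniformizer.exists_norm_coeff_max`). If `j` is the first index with `|aⱼ| = M`, then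
`|aᵢ| ≤ |π| M` for `i < j`, so the term of index `j` strictly dominates the others as soon as
`|π| < |x| ^ j` and `0 < |x| < 1`, and `|f(x)| = M |x| ^ j` there (`norm_eval_eq`). Put `x = uᵢ` and
let `i → ∞`.
-/

namespace LubinTate

variable {p : ℕ} [Fact p.Prime] {K : IntermediateField ℚ_[p] (PadicAlgCl p)}

theorem norm_incl_le_one (a : integers K) : ‖incl a‖ ≤ 1 := by
  have h := a.2
  rw [Valuation.mem_valuationSubring_iff] at h
  exact_mod_cast h

theorem incl_mul (a b : integers K) : incl (a * b) = incl a * incl b := rfl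

theorem incl_injective : Function.Injective (incl (K := K)) :=
  fun _ _ h => Subtype.ext (Subtype.ext h)

theorem incl_ne_zero {a : integers K} (ha : a ≠ 0) : incl a ≠ 0 :=
  fun h => ha (incl_injective h)

theorem mem_maximalIdeal_iff_norm_incl_lt_one (a : integers K) :
    a ∈ IsLocalRing.maximalIdeal (integers K) ↔ ‖incl a‖ < 1 := by
  have h := (Valuation.isEquiv_valuation_valuationSubring
    (NormedField.valuation (K := K))).lt_one_iff_lt_one (x := (a : K))
  exact (ValuationSubring.valuation_lt_one_iff _ a).trans h.symm

theorem IsUniformizer.norm_lt_one {π : integers K} (hπ : IsUniformizer π) : ‖incl π‖ < 1 := by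
  rw [← mem_maximalIdeal_iff_norm_incl_lt_one, hπ]
  exact Ideal.mem_span_singleton_self π

theorem IsUniformizer.ne_zero {π : integers K} (hπ : IsUniformizer π) : π ≠ 0 := by
  rintro rfl
  have h : incl ((p : integers K)) = algebraMap ℚ_[p] (PadicAlgCl p) p := by
    rw [map_natCast]; rfl
  have hp : (p : integers K) ∈ IsLocalRing.maximalIdeal (integers K) := by
    rw [mem_maximalIdeal_iff_norm_incl_lt_one, h, norm_algebraMap']
    exact Padic.norm_p_lt_one
  rw [hπ, Ideal.mem_span_singleton, zero_dvd_iff] at hp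
  have h0 : incl (0 : integers K) = 0 := rfl
  rw [hp, h0, map_natCast, eq_comm, Nat.cast_eq_zero] at h
  exact (Fact.out : p.Prime).ne_zero h

/-- There is no absolute value strictly between `|π| |b|` and `|b|`. -/
theorem IsUniformizer.norm_le_mul_of_lt {π : integers K} (hπ : IsUniformizer π)
    {a b : integers K} (h : ‖incl a‖ < ‖incl b‖) : ‖incl a‖ ≤ ‖incl π‖ * ‖incl b‖ := by
  have hb : 0 < ‖incl b‖ := (norm_nonneg _).trans_lt h
  have hlt : ‖incl a / incl b‖ < 1 := by rwa [norm_div, div_lt_one hb]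
  let c : integers K := ⟨(a : K) / (b : K), by
    rw [Valuation.mem_valuationSubring_iff]
    exact_mod_cast hlt.le⟩
  have hc : c ∈ IsLocalRing.maximalIdeal (integers K) :=
    (mem_maximalIdeal_iff_norm_incl_lt_one c).2 hlt
  rw [hπ, Ideal.mem_span_singleton] at hc
  obtain ⟨d, hd⟩ := hc
  have hle : ‖incl a / incl b‖ ≤ ‖incl π‖ := by
    change ‖incl c‖ ≤ _
    rw [hd, incl_mul, norm_mul]
    exact mul_le_of_le_one_right (norm_nonneg _) (norm_incl_le_one d)
  rwa [norm_div, div_le_iff₀ hb] at hle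

theorem IsUniformizer.exists_norm_coeff_max {π : integers K} (hπ : IsUniformizer π)
    {f : PowerSeries (integers K)} (hf : f ≠ 0) :
    ∃ j, PowerSeries.coeff j f ≠ 0 ∧
      ∀ i, ‖incl (PowerSeries.coeff i f)‖ ≤ ‖incl (PowerSeries.coeff j f)‖ := by
  classical
  have hπ0 : 0 < ‖incl π‖ := norm_pos_iff.2 (incl_ne_zero hπ.ne_zero)
  have hex : ∃ n : ℕ, ∃ j, ‖incl π‖ ^ n ≤ ‖incl (PowerSeries.coeff j f)‖ := by
    obtain ⟨k, hk⟩ : ∃ k, PowerSeries.coeff k f ≠ 0 := by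
      by_contra! h
      exact hf (PowerSeries.ext h)
    obtain ⟨n, hn⟩ := exists_pow_lt_of_lt_one (norm_pos_iff.2 (incl_ne_zero hk)) hπ.norm_lt_one
    exact ⟨n, k, hn.le⟩
  obtain ⟨j, hj⟩ := Nat.find_spec hex
  refine ⟨j, fun h => ?_, fun i => ?_⟩
  · rw [h] at hj
    exact (hj.trans_eq norm_zero).not_gt (pow_pos hπ0 _)
  · by_contra! hlt
    cases hn : Nat.find hex with
    | zero =>
      rw [hn, pow_zero] at hj
      exact (hj.trans_lt hlt).not_ge (norm_incl_le_one _)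
    | succ n =>
      refine Nat.find_min hex (m := n) (by omega) ⟨i, ?_⟩
      rw [hn, pow_succ'] at hj
      exact le_of_mul_le_mul_left (hj.trans (hπ.norm_le_mul_of_lt hlt)) hπ0

/-- `PadicAlgCl p` is not complete; the series converges because all its terms lie in the field
`K(x)`, which is finite-dimensional over `ℚ_p` and hence complete. -/
theorem summable_eval [FiniteDimensional ℚ_[p] K] (g : PowerSeries (integers K))
    {x : PadicAlgCl p} (hx : ‖x‖ < 1) :
    Summable fun n : ℕ => incl (PowerSeries.coeff n g) * x ^ n := by
  have : FiniteDimensional ℚ_[p] (IntermediateField.adjoin ℚ_[p] {x}) :=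
    IntermediateField.adjoin.finiteDimensional (Algebra.IsAlgebraic.isAlgebraic x).isIntegral
  let L : IntermediateField ℚ_[p] (PadicAlgCl p) := K ⊔ IntermediateField.adjoin ℚ_[p] {x}
  let V : Submodule ℚ_[p] (PadicAlgCl p) := Subalgebra.toSubmodule L.toSubalgebra
  have hfin : FiniteDimensional ℚ_[p] L := inferInstance
  have hV : FiniteDimensional ℚ_[p] V := hfin
  have : CompleteSpace V := FiniteDimensional.complete ℚ_[p] V
  have hmem (n : ℕ) : incl (PowerSeries.coeff n g) * x ^ n ∈ L := by
    refine mul_mem ?_ (pow_mem ?_ n)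
    · exact (le_sup_left : K ≤ L) ((PowerSeries.coeff n g : integers K) : K).2
    · exact (le_sup_right : _ ≤ L) (IntermediateField.mem_adjoin_simple_self ℚ_[p] x)
  have hsum : Summable fun n => (⟨_, hmem n⟩ : V) := by
    refine Summable.of_norm_bounded (summable_geometric_of_lt_one (norm_nonneg x) hx) fun n => ?_
    change ‖incl (PowerSeries.coeff n g) * x ^ n‖ ≤ _
    rw [norm_mul, norm_pow]
    exact mul_le_of_le_one_left (by positivity) (norm_incl_le_one _)
  exact hsum.map V.subtypeL V.subtypeL.continuous

/-- Near the boundary of the open unit disc, the first coefficient of maximal absolute value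
dominates the series. -/
theorem norm_eval_eq [FiniteDimensional ℚ_[p] K] {π : integers K} (hπ : IsUniformizer π)
    {f : PowerSeries (integers K)} {j : ℕ} (hj : PowerSeries.coeff j f ≠ 0)
    (hmax : ∀ i, ‖incl (PowerSeries.coeff i f)‖ ≤ ‖incl (PowerSeries.coeff j f)‖)
    (hfirst : ∀ i < j, ‖incl (PowerSeries.coeff i f)‖ < ‖incl (PowerSeries.coeff j f)‖)
    {x : PadicAlgCl p} (hx0 : x ≠ 0) (hx : ‖x‖ < 1) (hxπ : ‖incl π‖ < ‖x‖ ^ j) :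
    ‖eval f x‖ = ‖incl (PowerSeries.coeff j f)‖ * ‖x‖ ^ j := by
  have hM : 0 < ‖incl (PowerSeries.coeff j f)‖ := norm_pos_iff.2 (incl_ne_zero hj)
  have hx0' : 0 < ‖x‖ := norm_pos_iff.2 hx0
  set M := ‖incl (PowerSeries.coeff j f)‖ with hMdef
  have hrest : ‖∑' n, if n = j then 0 else incl (PowerSeries.coeff n f) * x ^ n‖ <
      M * ‖x‖ ^ j := by
    refine (IsUltrametricDist.norm_tsum_le_of_forall_le_of_nonneg
      (C := max (‖incl π‖ * M) (M * ‖x‖ ^ (j + 1))) (by positivity) fun n => ?_).trans_lt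
      (max_lt ?_ ?_)
    · split_ifs with h
      · rw [norm_zero]; positivity
      rw [norm_mul, norm_pow]
      rcases lt_or_gt_of_ne h with h | h
      · refine le_max_of_le_left ?_
        exact (mul_le_of_le_one_right (norm_nonneg _) (pow_le_one₀ hx0'.le hx.le)).trans
          (hπ.norm_le_mul_of_lt (hfirst n h))
      · refine le_max_of_le_right ?_
        exact mul_le_mul (hmax n) (pow_le_pow_of_le_one hx0'.le hx.le h) (by positivity) hM.le
    · rw [mul_comm]
      exact mul_lt_mul_of_pos_left hxπ hM
    · exact mul_lt_mul_of_pos_left (pow_lt_pow_right_of_lt_one₀ hx0' hx j.lt_succ_self) hM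
  have hmain : ‖incl (PowerSeries.coeff j f) * x ^ j‖ = M * ‖x‖ ^ j := by
    rw [norm_mul, norm_pow]
  rw [eval, (summable_eval f hx).tsum_eq_add_tsum_ite j,
    IsUltrametricDist.norm_add_eq_max_of_norm_ne_norm (by rw [hmain]; exact hrest.ne'), hmain,
    max_eq_left hrest.le]

theorem IsLubinTate.one_lt_residueCard {F : FormalGroup (integers K)} {π : integers K}
    {φ : PowerSeries (integers K)} (hF : IsLubinTate F π φ) : 1 < residueCard K := by
  have h1 : residueCard K ≠ 1 := fun h =>
    not_subsingleton (IsLocalRing.ResidueField (integers K)) (Nat.card_eq_one_iff_unique.1 h).1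
  -- An infinite residue field would give `residueCard K = 0`, hence `φ(0) ≡ 1` modulo `π`.
  have h0 : residueCard K ≠ 0 := fun h => by
    have hd := hF.modEq_frobenius 0
    rw [h, pow_zero, map_sub, PowerSeries.coeff_zero_eq_constantCoeff_apply,
      hF.isScalarSeries.isEndomorphism.constantCoeff_eq_zero,
      PowerSeries.coeff_zero_eq_constantCoeff_apply, map_one, zero_sub, dvd_neg] at hd
    refine (Ideal.ne_top_iff_one _).1
      (IsLocalRing.maximalIdeal.isMaximal (integers K)).ne_top ?_
    rw [hF.isUniformizer]
    exact Ideal.mem_span_singleton.2 hd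
  omega

theorem IsLubinTate.norm_eval_le {F : FormalGroup (integers K)} {π : integers K}
    {φ : PowerSeries (integers K)} (hF : IsLubinTate F π φ) {x : PadicAlgCl p} (hx : ‖x‖ < 1) :
    ‖eval φ x‖ ≤ max (‖x‖ ^ residueCard K) (‖incl π‖ * ‖x‖) := by
  refine IsUltrametricDist.norm_tsum_le_of_forall_le_of_nonneg (by positivity) fun n => ?_
  rw [norm_mul, norm_pow]
  by_cases hq : n = residueCard K
  · rw [hq]
    exact le_max_of_le_left (mul_le_of_le_one_left (by positivity) (norm_incl_le_one _))
  refine le_max_of_le_right ?_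
  rcases Nat.eq_zero_or_pos n with rfl | hn
  · rw [PowerSeries.coeff_zero_eq_constantCoeff_apply,
      hF.isScalarSeries.isEndomorphism.constantCoeff_eq_zero]
    have h0 : incl (0 : integers K) = 0 := rfl
    rw [h0, norm_zero, zero_mul]
    positivity
  obtain ⟨c, hc⟩ := hF.modEq_frobenius n
  rw [map_sub, PowerSeries.coeff_X_pow, if_neg hq, sub_zero] at hc
  rw [hc, incl_mul, norm_mul]
  exact mul_le_mul (mul_le_of_le_one_right (norm_nonneg _) (norm_incl_le_one c))
    (pow_le_of_le_one (norm_nonneg x) hx.le hn.ne') (by positivity) (norm_nonneg _)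

/-- The absolute values increase, and their limit `L` satisfies `L ≤ max (L ^ q) (|π| L)`, which is
impossible for `0 < L < 1`. -/
theorem IsTorsionSequence.tendsto_norm {F : FormalGroup (integers K)} {π : integers K}
    {φ : PowerSeries (integers K)} (hF : IsLubinTate F π φ) {u : ℕ → PadicAlgCl p}
    (hu : IsTorsionSequence φ u) :
    Tendsto (fun n => ‖u n‖) atTop (𝓝 1) := by
  have hlt (n : ℕ) : ‖u n‖ < 1 := (hu.mem_torsion n).1
  have hstep (n : ℕ) :
      ‖u n‖ ≤ max (‖u (n + 1)‖ ^ residueCard K) (‖incl π‖ * ‖u (n + 1)‖) := by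
    have h := hF.norm_eval_le (hlt (n + 1))
    rwa [hu.eval_succ] at h
  have hq := hF.one_lt_residueCard
  have hπ := hF.isUniformizer.norm_lt_one
  have hmono : Monotone fun n => ‖u n‖ := monotone_nat_of_le_succ fun n =>
    (hstep n).trans (max_le (pow_le_of_le_one (norm_nonneg _) (hlt _).le (by omega))
      (mul_le_of_le_one_left (norm_nonneg _) hπ.le))
  have hbdd : BddAbove (Set.range fun n => ‖u n‖) :=
    ⟨1, Set.forall_mem_range.2 fun n => (hlt n).le⟩
  have hlim := tendsto_atTop_ciSup hmono hbdd
  set L := ⨆ n, ‖u n‖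
  have hL0 : 0 < L := (norm_pos_iff.2 hu.ne_zero).trans_le (le_ciSup hbdd 0)
  have hL1 : L ≤ 1 := ciSup_le fun n => (hlt n).le
  have hlim' := hlim.comp (tendsto_add_atTop_nat 1)
  have hL : L ≤ max (L ^ residueCard K) (‖incl π‖ * L) :=
    le_of_tendsto_of_tendsto' hlim ((hlim'.pow _).max (hlim'.const_mul _)) hstep
  have hLeq : L = 1 := by
    refine le_antisymm hL1 (not_lt.1 fun h => hL.not_gt (max_lt ?_ ?_))
    · simpa using pow_lt_pow_right_of_lt_one₀ hL0 h hq
    · exact mul_lt_of_lt_one_left hL0 hπ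
  rwa [hLeq] at hlim

theorem IsTorsionSequence.apply_ne_zero {F : FormalGroup (integers K)} {π : integers K}
    {φ : PowerSeries (integers K)} (hF : IsLubinTate F π φ) {u : ℕ → PadicAlgCl p}
    (hu : IsTorsionSequence φ u) (n : ℕ) : u n ≠ 0 := by
  induction n with
  | zero => exact hu.ne_zero
  | succ n ih =>
    intro h
    have hn := hF.norm_eval_le (hu.mem_torsion (n + 1)).1
    have hq := hF.one_lt_residueCard
    rw [hu.eval_succ, h, norm_zero, mul_zero, zero_pow (by omega), max_self] at hn
    exact ih (norm_le_zero_iff.1 hn)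

end LubinTate

theorem lemma3p2p1 (p : ℕ) [Fact p.Prime]
    (K : IntermediateField ℚ_[p] (PadicAlgCl p)) [FiniteDimensional ℚ_[p] K]
    (π : LubinTate.integers K) (φ : PowerSeries (LubinTate.integers K))
    (F : FormalGroup (LubinTate.integers K)) (hF : LubinTate.IsLubinTate F π φ)
    (u : ℕ → PadicAlgCl p) (hu : LubinTate.IsTorsionSequence φ u)
    (α : ∀ n, LubinTate.level φ n) (hα : α ∈ LubinTate.compatibleSequences F π φ)
    (f : PowerSeries (LubinTate.integers K)) (hf : f ≠ 0)
    (hfα : ∀ i, LubinTate.eval f (u i) = (α i : PadicAlgCl p)) :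
    ∃ l : ℝ, l ≠ 0 ∧ Tendsto (fun i => ‖(α i : PadicAlgCl p)‖) atTop (𝓝 l) ∧
      IsGreatest (Set.range fun j => ‖LubinTate.incl (PowerSeries.coeff j f)‖) l := by
  classical
  obtain ⟨k, hk0, hk⟩ := hF.isUniformizer.exists_norm_coeff_max hf
  have hex : ∃ j, ‖LubinTate.incl (PowerSeries.coeff j f)‖ =
      ‖LubinTate.incl (PowerSeries.coeff k f)‖ := ⟨k, rfl⟩
  let j := Nat.find hex
  have hjk : ‖LubinTate.incl (PowerSeries.coeff j f)‖ =
      ‖LubinTate.incl (PowerSeries.coeff k f)‖ := Nat.find_spec hex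
  have hM : ‖LubinTate.incl (PowerSeries.coeff j f)‖ ≠ 0 := by
    rw [hjk]
    exact norm_ne_zero_iff.2 (LubinTate.incl_ne_zero hk0)
  have hj0 : PowerSeries.coeff j f ≠ 0 := fun h => hM (by rw [h]; exact norm_zero)
  have hmax (i : ℕ) : ‖LubinTate.incl (PowerSeries.coeff i f)‖ ≤
      ‖LubinTate.incl (PowerSeries.coeff j f)‖ := (hk i).trans_eq hjk.symm
  have hfirst (i : ℕ) (hi : i < j) : ‖LubinTate.incl (PowerSeries.coeff i f)‖ <
      ‖LubinTate.incl (PowerSeries.coeff j f)‖ :=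
    (hmax i).lt_of_ne fun h => Nat.find_min hex hi (h.trans hjk)
  have hpow : Tendsto (fun n => ‖u n‖ ^ j) atTop (𝓝 1) := by
    simpa using (hu.tendsto_norm hF).pow j
  refine ⟨_, hM, ?_, ⟨j, rfl⟩, Set.forall_mem_range.2 hmax⟩
  have hlim := hpow.const_mul (‖LubinTate.incl (PowerSeries.coeff j f)‖)
  rw [mul_one] at hlim
  refine hlim.congr' ?_
  filter_upwards [hpow.eventually_const_lt hF.isUniformizer.norm_lt_one] with n hn
  rw [← hfα, LubinTate.norm_eval_eq hF.isUniformizer hj0 hmax hfirst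
    (hu.apply_ne_zero hF n) (hu.mem_torsion n).1 hn]
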